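/- Let $N\ge 1$. Define differential polynomials $L_k[u]$ by $L_0[u]=\tfrac12$ and $\frac{d}{dz}L_{k+1}[u]=\left(\frac{d^3}{dz^3}+4u\frac{d}{dz}+2u_z\right)L_k[u]$, with zero constants of integration, and let $$P_2^{(N)}[w,\alpha]=\left(\frac{d}{dz}+2w\right)L_N[w'-w^2]-zw-\alpha$$ be the left-hand side of the $N$-th equation of the second Painlevé hierarchy. Let $Q_n^{(N)}\in\mathbb{C}[z]$, $n\ge 0$, be the (generalised) Yablonskii–Vorob'ev polynomials: $Q_0^{(N)}=1$, every $Q_n^{(N)}$ is monic, and for every $n\ge 1$ the rational function $w=\frac{d}{dz}\ln\frac{Q_{n-1}^{(N)}}{Q_n^{(N)}}$ satisfies $P_2^{(N)}[w,n]=0$. For $m\ge 1$ let $s_{n,m}^{(N)}$ be the sum of the $m$-th powers of the roots of $Q_n^{(N)}$, counted with multiplicity. 1. Let $n\ge 2$ and $p=n(n+1)/2$. Then $\deg Q_n^{(N)}=p$, and the power sums $s_{n,m}^{(N)}$ with $m>p$ carry no new information about the roots of $Q_n^{(N)}$: writing $Q_n^{(N)}(z)=\sum_{k=0}^{p}A_k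 z^{p-k}$ with $A_0=1$, and $s_m=s_{n,m}^{(N)}$, Newton's identities $$kA_k+\sum_{j=1}^{k}s_jA_{k-j}=0\quad(1\le k\le p),\qquad s_m+\sum_{j=1}^{p}A_j s_{m-j}=0\quad(m>p)$$ hold, so that $s_1,\dots,s_p$ determine $Q_n^{(N)}$ and all the $s_m$; moreover for every $m>p$ there is a polynomial $F$ in $p$ variables with rational coefficients, depending only on $p$ and $m$, such that $s_m=F(s_1,\dots,s_p)$ holds for the power sums of the roots of every monic polynomial of degree $p$ over $\mathbb{C}$, in particular for those of $Q_n^{(N)}$. 2. For every $l\ge 1$, $s_{n,(2N+1)l}^{(N)}$ is a polynomial in $n$ of degree $2(Nl+1)$: there is $S\in\mathbb{C}[x]$ of degree exactly $2(Nl+1)$, depending only on $N$ and $l$, with $s_{n,(2N+1)l}^{(N)}=S(n)$ for all $n\ge 0$. -/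

import Mathlib

open Polynomial
open scoped BigOperators

noncomputable section

namespace PainleveTwo

/-- Differential polynomials in one unknown `u`: the variable `X k` stands for the `k`-th
derivative `d^k u / dz^k`. -/
abbrev DiffPoly : Type := MvPolynomial ℕ ℂ

/-- The total derivative `d/dz` on differential polynomials: `X k ↦ X (k + 1)`. -/
def totalDeriv : Derivation ℂ DiffPoly DiffPoly :=
  MvPolynomial.mkDerivation ℂ fun k => MvPolynomial.X (k + 1)

/-- The Lenard differential polynomials `L_0 = 1/2`, `L_1 = u`, `L_2 = u'' + 3u²`, …, given by the
integrated form of the Lenard recursion. The relation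
`d/dz L_{N+1} = (d³/dz³ + 4 u d/dz + 2 u') L_N` is proved in `totalDeriv_lenard_succ`, and the
vanishing of the integration constants in `constantCoeff_lenard_succ`. -/
def lenard : ℕ → DiffPoly
  | 0 => MvPolynomial.C (1 / 2)
  | n + 1 =>
      2 * ∑ i : Fin (n + 1),
          (lenard i * totalDeriv (totalDeriv (lenard (n - i)))
            - MvPolynomial.C (1 / 2) * (totalDeriv (lenard i) * totalDeriv (lenard (n - i)))
            + 2 * MvPolynomial.X 0 * (lenard i * lenard (n - i)))
        - ∑ i : Fin n, lenard (i + 1) * lenard (n - i)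
  termination_by n => n
  decreasing_by all_goals omega

/-- The derivative of a rational function, by the quotient rule. -/
def ratDeriv (f : RatFunc ℂ) : RatFunc ℂ :=
  (algebraMap ℂ[X] (RatFunc ℂ) (derivative f.num * f.denom - f.num * derivative f.denom))
    / algebraMap ℂ[X] (RatFunc ℂ) f.denom ^ 2

/-- The value `P[u]` of a differential polynomial `P` at a rational function `u`. -/
def DiffPoly.evalAt (P : DiffPoly) (u : RatFunc ℂ) : RatFunc ℂ :=
  MvPolynomial.aeval (fun k => ratDeriv^[k] u) P

/-- The left-hand side `(d/dz + 2w) L_N[w' - w²] - z w - α` of the `N`-th equation of the second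
Painlevé hierarchy, at a rational function `w`. -/
def painleveTwo (N : ℕ) (w : RatFunc ℂ) (α : ℂ) : RatFunc ℂ :=
  ratDeriv ((lenard N).evalAt (ratDeriv w - w ^ 2))
    + 2 * w * (lenard N).evalAt (ratDeriv w - w ^ 2)
    - RatFunc.X * w - RatFunc.C α

/-- The logarithmic derivative `d/dz ln (P / Q)` of a quotient of polynomials. -/
def logDerivQuot (P Q : ℂ[X]) : RatFunc ℂ :=
  ratDeriv (algebraMap ℂ[X] (RatFunc ℂ) P / algebraMap ℂ[X] (RatFunc ℂ) Q)
    / (algebraMap ℂ[X] (RatFunc ℂ) P / algebraMap ℂ[X] (RatFunc ℂ) Q)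

/-- `IsYablonskiiVorobev N n Q`: the polynomial `Q` is the `n`-th (generalised)
Yablonskii–Vorob'ev polynomial `Q_n^{(N)}` of the `N`-th equation of the second Painlevé hierarchy.
That is, `Q_0 = 1`, all `Q_n` are monic, and for `n ≥ 1` the rational function
`w = d/dz ln (Q_{n-1} / Q_n)` solves the `N`-th equation with `α = n`. -/
inductive IsYablonskiiVorobev (N : ℕ) : ℕ → ℂ[X] → Prop
  | zero : IsYablonskiiVorobev N 0 1
  | succ {n : ℕ} {P Q : ℂ[X]} (hP : IsYablonskiiVorobev N n P) (hQ : Q.Monic)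
      (hw : painleveTwo N (logDerivQuot P Q) ((n + 1 : ℕ) : ℂ) = 0) :
      IsYablonskiiVorobev N (n + 1) Q

/-- The sum of the `m`-th powers of the roots of `Q`, counted with multiplicity. -/
def rootPowerSum (Q : ℂ[X]) (m : ℕ) : ℂ :=
  (Q.roots.map fun a => a ^ m).sum

/-! ### The Lenard recursion -/

theorem constantCoeff_totalDeriv (P : DiffPoly) :
    MvPolynomial.constantCoeff (totalDeriv P) = 0 := by
  induction P using MvPolynomial.induction_on with
  | C a => simp [totalDeriv, MvPolynomial.derivation_C]
  | add p q hp hq => simp [hp, hq]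
  | mul_X p k hp => simp [totalDeriv, MvPolynomial.mkDerivation_X]

/-- The integration constants in the Lenard recursion are all zero. -/
theorem constantCoeff_lenard_succ (n : ℕ) :
    MvPolynomial.constantCoeff (lenard (n + 1)) = 0 := by
  induction n using Nat.strong_induction_on with
  | _ n ih =>
    rw [lenard]
    simp only [map_sub, map_mul, map_sum, map_add, constantCoeff_totalDeriv,
      MvPolynomial.constantCoeff_X, mul_zero, zero_mul, sub_zero, add_zero,
      Finset.sum_const_zero, zero_sub, neg_eq_zero]
    refine Finset.sum_eq_zero fun i _ => ?_
    rw [ih i i.2, zero_mul]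

/-- The defining quadratic relation, with all terms of degree two on the left. -/
theorem lenard_quadratic (n : ℕ) :
    ∑ ij ∈ Finset.HasAntidiagonal.antidiagonal (n + 1), lenard ij.1 * lenard ij.2
      = 2 * ∑ ij ∈ Finset.HasAntidiagonal.antidiagonal n,
          (lenard ij.1 * totalDeriv (totalDeriv (lenard ij.2))
            - MvPolynomial.C (1 / 2) * (totalDeriv (lenard ij.1) * totalDeriv (lenard ij.2))
            + 2 * MvPolynomial.X 0 * (lenard ij.1 * lenard ij.2)) := by
  have h := lenard.eq_2 n
  rw [Fin.sum_univ_eq_sum_range (fun i => lenard i * totalDeriv (totalDeriv (lenard (n - i)))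
            - MvPolynomial.C (1 / 2) * (totalDeriv (lenard i) * totalDeriv (lenard (n - i)))
            + 2 * MvPolynomial.X 0 * (lenard i * lenard (n - i))),
    Fin.sum_univ_eq_sum_range (fun i => lenard (i + 1) * lenard (n - i))] at h
  rw [Finset.Nat.sum_antidiagonal_eq_sum_range_succ_mk,
    Finset.Nat.sum_antidiagonal_eq_sum_range_succ_mk]
  simp only
  rw [Finset.sum_range_succ', Finset.sum_range_succ]
  simp only [Nat.succ_eq_add_one, Nat.sub_self, Nat.sub_zero, Nat.add_sub_add_right]
  have h0 : lenard 0 + lenard 0 = 1 := by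
    rw [lenard, ← MvPolynomial.C_add]
    norm_num
  linear_combination h + lenard (n + 1) * h0

/-- The Lenard recursion `d/dz L_{N+1} = (d³/dz³ + 4 u d/dz + 2 u') L_N`. -/
theorem totalDeriv_lenard_succ (n : ℕ) :
    totalDeriv (lenard (n + 1))
      = totalDeriv (totalDeriv (totalDeriv (lenard n)))
        + 4 * MvPolynomial.X 0 * totalDeriv (lenard n)
        + 2 * MvPolynomial.X 1 * lenard n := by
  set T : DiffPoly → DiffPoly := fun P => totalDeriv (totalDeriv (totalDeriv P))
        + 4 * MvPolynomial.X 0 * totalDeriv P + 2 * MvPolynomial.X 1 * P with hT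
  have hX : totalDeriv (MvPolynomial.X 0) = MvPolynomial.X 1 := by
    simp [totalDeriv, MvPolynomial.mkDerivation_X]
  have hC : ∀ a : ℂ, totalDeriv (MvPolynomial.C a) = 0 := fun a =>
    MvPolynomial.derivation_C totalDeriv a
  have hC2 : (MvPolynomial.C 2 : DiffPoly) = 2 := map_ofNat MvPolynomial.C 2
  have h2 : totalDeriv (2 : DiffPoly) = 0 := hC2 ▸ hC 2
  have hhalf : (MvPolynomial.C (1 / 2) : DiffPoly) * 2 = 1 := by
    rw [← hC2, ← MvPolynomial.C_mul]
    norm_num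
  have hD0 : totalDeriv (lenard 0) = 0 := by rw [lenard]; exact hC _
  have swap : ∀ (m : ℕ) (f : ℕ → ℕ → DiffPoly),
      ∑ ij ∈ Finset.HasAntidiagonal.antidiagonal m, f ij.1 ij.2
        = ∑ ij ∈ Finset.HasAntidiagonal.antidiagonal m, f ij.2 ij.1 := fun m f =>
    (Finset.Nat.sum_antidiagonal_swap (f := fun ij => f ij.1 ij.2)).symm
  -- the differentiated quadratic relation
  have key : ∀ n, ∑ ij ∈ Finset.HasAntidiagonal.antidiagonal n,
      lenard ij.1 * (totalDeriv (lenard (ij.2 + 1)) - T (lenard ij.2)) = 0 := by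
    intro n
    let h : ℕ → ℕ → DiffPoly := fun i j =>
      MvPolynomial.C (1 / 2) * (totalDeriv (lenard i) * totalDeriv (totalDeriv (lenard j)))
        + 2 * MvPolynomial.X 0 * (totalDeriv (lenard i) * lenard j)
    have q := congrArg totalDeriv (lenard_quadratic n)
    rw [Derivation.leibniz, h2, smul_zero, add_zero, map_sum, map_sum, smul_eq_mul] at q
    have ql : ∑ ij ∈ Finset.HasAntidiagonal.antidiagonal (n + 1),
          totalDeriv (lenard ij.1 * lenard ij.2)
        = 2 * ∑ ij ∈ Finset.HasAntidiagonal.antidiagonal n,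
            lenard ij.1 * totalDeriv (lenard (ij.2 + 1)) := by
      simp only [Derivation.leibniz, smul_eq_mul, Finset.sum_add_distrib]
      rw [swap (n + 1) fun i j => lenard j * totalDeriv (lenard i), ← two_mul,
        Finset.Nat.antidiagonal_succ']
      simp [hD0]
    have qr : ∑ ij ∈ Finset.HasAntidiagonal.antidiagonal n, totalDeriv
          (lenard ij.1 * totalDeriv (totalDeriv (lenard ij.2))
            - MvPolynomial.C (1 / 2) * (totalDeriv (lenard ij.1) * totalDeriv (lenard ij.2))
            + 2 * MvPolynomial.X 0 * (lenard ij.1 * lenard ij.2))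
        = ∑ ij ∈ Finset.HasAntidiagonal.antidiagonal n,
            (lenard ij.1 * T (lenard ij.2) + (h ij.1 ij.2 - h ij.2 ij.1)) := by
      refine Finset.sum_congr rfl fun ij _ => ?_
      simp only [map_sub, map_add, Derivation.leibniz, smul_eq_mul, hC, h2, hX, hT, h]
      linear_combination (-(totalDeriv (lenard ij.1) * totalDeriv (totalDeriv (lenard ij.2)))) * hhalf
    rw [ql, qr, Finset.sum_add_distrib, Finset.sum_sub_distrib, swap n h, sub_self, add_zero] at q
    simp only [mul_sub, Finset.sum_sub_distrib]
    exact sub_eq_zero.2 (mul_left_cancel₀ two_ne_zero q)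
  induction n using Nat.strong_induction_on with
  | _ n ih =>
    have hk := key n
    rw [Finset.sum_eq_single (0, n)] at hk
    · have h0 : lenard 0 ≠ 0 := by
        rw [lenard]
        simp
      exact sub_eq_zero.1 ((mul_eq_zero.1 hk).resolve_left h0)
    · rintro ⟨i, j⟩ hij hne
      rw [Finset.HasAntidiagonal.mem_antidiagonal] at hij
      have hj : j < n := by
        rcases Nat.eq_zero_or_pos i with rfl | hi
        · exact absurd (by simpa using hij) hne
        · simp only at hij
          omega
      rw [ih j hj]
      simp [hT]
    · simp

end PainleveTwo

end

/-!
At infinity `w = d/dz ln (Q_{n-1} / Q_n)` expands as `∑ (s_{n-1,m} - s_{n,m}) / z ^ (m + 1)`.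
Dividing the equation by `z` exhibits this expansion as a fixed point of a map contracting in the
`1 / z`-adic topology, so its coefficient at `z ^ (-1 - (2N+1) l)` is a polynomial `c_l(n)` in the
parameter, and Faulhaber's formula sums `-c_l` to `s_{n,(2N+1) l}`.

For the degree of `c_l`, let `c_l(β, δ)` be the same coefficient with parameter `β` and `d/dz`
replaced by `δ d/dz`. The scaling `z ↦ e^(2N) z`, `w ↦ e w` makes it homogeneous of degree
`2Nl + 1`, whence `c_l(x) = x^(2Nl+1) c_l(1, 1/x)`, and it remains to see that `c_l(1, 0) ≠ 0`. At
`δ = 0` the differential equation becomes the algebraic equation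
`(-1)^N binom(2N, N) w^(2N+1) - z w = 1`, whose solution has Fuss–Catalan coefficients up to a
nonzero factor.
-/

noncomputable section

namespace PainleveTwo

open Finset.HasAntidiagonal (antidiagonal)

/-! ### Differential polynomials in a differential algebra -/

section DifferentialAlgebra

variable {A B : Type*} [CommRing A] [Algebra ℂ A] [CommRing B] [Algebra ℂ B]

/-- The value `P[u]` of a differential polynomial `P` at an element `u` of an algebra `A`, where `d`
plays the role of `d/dz`. As `ratDeriv` is not a bundled derivation, `d` is an arbitrary map. -/
def evalDiff (d : A → A) (u : A) : DiffPoly →ₐ[ℂ] A :=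
  MvPolynomial.aeval fun k => d^[k] u

/-- The differential part `(d + 2w) L_N[dw - w²]` of the `N`-th equation of the hierarchy, where
`d` plays the role of `d/dz`. -/
def hierarchyOp (N : ℕ) (d : A → A) (w : A) : A :=
  d (evalDiff d (d w - w ^ 2) (lenard N)) + 2 * w * evalDiff d (d w - w ^ 2) (lenard N)

theorem evalDiff_X (d : A → A) (u : A) (k : ℕ) :
    evalDiff d u (MvPolynomial.X k) = d^[k] u :=
  MvPolynomial.aeval_X _ k

theorem evalDiff_C (d : A → A) (u : A) (a : ℂ) :
    evalDiff d u (MvPolynomial.C a) = algebraMap ℂ A a :=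
  MvPolynomial.aeval_C _ a

theorem evalDiff_totalDeriv (d : Derivation ℂ A A) (u : A) (P : DiffPoly) :
    evalDiff d u (totalDeriv P) = d (evalDiff d u P) := by
  induction P using MvPolynomial.induction_on with
  | C a => rw [totalDeriv, MvPolynomial.derivation_C, evalDiff_C, map_zero, d.map_algebraMap]
  | add p q hp hq => simp only [map_add, hp, hq]
  | mul_X p k hp =>
    have hX : evalDiff d u (totalDeriv (MvPolynomial.X k)) = d (d^[k] u) := by
      rw [totalDeriv, MvPolynomial.mkDerivation_X, evalDiff_X, Function.iterate_succ_apply']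
    simp only [Derivation.leibniz, smul_eq_mul, map_add, map_mul, hp, hX, evalDiff_X]

theorem map_evalDiff (g : A →ₐ[ℂ] B) {d : A → A} {e : B → B}
    (hg : Function.Semiconj g d e) (u : A) (P : DiffPoly) :
    g (evalDiff d u P) = evalDiff e (g u) P := by
  have hiter (k : ℕ) : g (d^[k] u) = e^[k] (g u) := (hg.iterate_right k).eq u
  rw [evalDiff, ← AlgHom.comp_apply, MvPolynomial.comp_aeval]
  simp only [hiter, evalDiff]

theorem map_hierarchyOp (N : ℕ) (g : A →ₐ[ℂ] B) {d : A → A} {e : B → B}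
    (hg : Function.Semiconj g d e) (w : A) :
    g (hierarchyOp N d w) = hierarchyOp N e (g w) := by
  simp only [hierarchyOp, map_add, map_mul, hg.eq, map_evalDiff g hg, map_sub, map_pow, map_ofNat]

theorem evalDiff_sub_mem {d : Derivation ℂ A A} {I : Ideal A} (hI : ∀ x ∈ I, d x ∈ I) {u v : A}
    (huv : u - v ∈ I) (P : DiffPoly) : evalDiff d u P - evalDiff d v P ∈ I := by
  induction P using MvPolynomial.induction_on with
  | C a => simp only [evalDiff_C, sub_self, I.zero_mem]
  | add p q hp hq =>
    rw [map_add, map_add, add_sub_add_comm]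
    exact I.add_mem hp hq
  | mul_X p k hp =>
    have hiter : d^[k] u - d^[k] v ∈ I := by
      rw [← iterate_map_sub]
      exact Set.MapsTo.iterate (s := (I : Set A)) hI k huv
    rw [map_mul, map_mul, evalDiff_X, evalDiff_X, ← sub_add_sub_cancel _ (evalDiff d u p * d^[k] v),
      ← mul_sub, ← sub_mul]
    exact I.add_mem (I.mul_mem_left _ hiter) (I.mul_mem_right _ hp)

theorem hierarchyOp_sub_mem (N : ℕ) {d : Derivation ℂ A A} {I : Ideal A}
    (hI : ∀ x ∈ I, d x ∈ I) {v w : A} (hvw : v - w ∈ I) :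
    hierarchyOp N d v - hierarchyOp N d w ∈ I := by
  have hu : (d v - v ^ 2) - (d w - w ^ 2) ∈ I := by
    rw [sub_sub_sub_comm, ← map_sub, sq_sub_sq]
    exact I.sub_mem (hI _ hvw) (I.mul_mem_left _ hvw)
  have hL := evalDiff_sub_mem hI hu (lenard N)
  have hdL := hI _ hL
  rw [map_sub] at hdL
  have hwL := I.add_mem (I.mul_mem_left (2 * v) hL)
    (I.mul_mem_left (2 * evalDiff d (d w - w ^ 2) (lenard N)) hvw)
  convert I.add_mem hdL hwL using 1
  simp only [hierarchyOp]
  ring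

theorem evalDiff_lenard_zero (d : A → A) (u : A) :
    evalDiff d u (lenard 0) = algebraMap ℂ A (1 / 2) := by
  rw [lenard, evalDiff_C]

theorem evalDiff_lenard_succ (d : Derivation ℂ A A) (u : A) (n : ℕ) :
    evalDiff d u (lenard (n + 1)) =
      2 * ∑ i ∈ Finset.range (n + 1),
          (evalDiff d u (lenard i) * d (d (evalDiff d u (lenard (n - i))))
            - algebraMap ℂ A (1 / 2)
              * (d (evalDiff d u (lenard i)) * d (evalDiff d u (lenard (n - i))))
            + 2 * u * (evalDiff d u (lenard i) * evalDiff d u (lenard (n - i))))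
        - ∑ i ∈ Finset.range n,
            evalDiff d u (lenard (i + 1)) * evalDiff d u (lenard (n - i)) := by
  rw [lenard]
  simp only [map_sub, map_mul, map_add, map_sum, map_ofNat, evalDiff_totalDeriv, evalDiff_C,
    evalDiff_X, Function.iterate_zero_apply, Finset.sum_range]

theorem evalDiff_smul (c : ℂ) (d : Derivation ℂ A A) (u : A) (n : ℕ) :
    evalDiff ⇑(c • d) (c ^ 2 • u) (lenard n) = c ^ (2 * n) • evalDiff d u (lenard n) := by
  induction n using Nat.strong_induction_on with
  | _ n ih =>
    cases n with
    | zero => simp only [evalDiff_lenard_zero, mul_zero, pow_zero, one_smul]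
    | succ n =>
      rw [evalDiff_lenard_succ, evalDiff_lenard_succ, smul_sub, ← mul_smul_comm, Finset.smul_sum,
        Finset.smul_sum]
      congr 1
      · congr 1
        refine Finset.sum_congr rfl fun i hi => ?_
        obtain ⟨j, rfl⟩ := Nat.exists_eq_add_of_le (Finset.mem_range_succ_iff.1 hi)
        rw [Nat.add_sub_cancel_left, ih i (by omega), ih j (by omega)]
        simp only [Derivation.smul_apply, Derivation.map_smul]
        simp only [Algebra.smul_def, map_pow]
        ring
      · refine Finset.sum_congr rfl fun i hi => ?_
        obtain ⟨j, rfl⟩ := Nat.exists_eq_add_of_lt (Finset.mem_range.1 hi)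
        rw [show i + j + 1 - i = j + 1 by omega, ih (i + 1) (by omega), ih (j + 1) (by omega)]
        simp only [Algebra.smul_def, map_pow]
        ring

theorem hierarchyOp_smul (N : ℕ) (c : ℂ) (d : Derivation ℂ A A) (w : A) :
    hierarchyOp N ⇑(c • d) (c • w) = c ^ (2 * N + 1) • hierarchyOp N d w := by
  have hu : (c • d) (c • w) - (c • w) ^ 2 = c ^ 2 • (d w - w ^ 2) := by
    rw [Derivation.smul_apply, Derivation.map_smul]
    simp only [Algebra.smul_def, map_pow]
    ring
  rw [hierarchyOp, hierarchyOp, hu, evalDiff_smul, Derivation.smul_apply, Derivation.map_smul]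
  simp only [Algebra.smul_def, map_pow]
  ring

/-! ### The dispersionless limit -/

theorem sum_evalDiff_zero_lenard (u : A) (n : ℕ) :
    ∑ ij ∈ antidiagonal (n + 1), evalDiff 0 u (lenard ij.1) * evalDiff 0 u (lenard ij.2)
      = 4 * u * ∑ ij ∈ antidiagonal n,
          evalDiff 0 u (lenard ij.1) * evalDiff 0 u (lenard ij.2) := by
  have hD (P : DiffPoly) : evalDiff 0 u (totalDeriv P) = 0 := evalDiff_totalDeriv 0 u P
  have h := congrArg (evalDiff 0 u) (lenard_quadratic n)
  simp only [map_sub, map_mul, map_add, map_sum, map_ofNat, hD, evalDiff_C, evalDiff_X,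
    Function.iterate_zero_apply, mul_zero, sub_zero, zero_add, ← Finset.mul_sum] at h
  rw [h]
  ring

/-- The generating series `∑ L_n[u] t ^ n` of the Lenard differential polynomials at a constant
`u`. -/
def dispersionlessLenard (u : A) : PowerSeries A :=
  PowerSeries.mk fun n => evalDiff 0 u (lenard n)

theorem dispersionlessLenard_mul_self (u : A) :
    dispersionlessLenard u * dispersionlessLenard u * (1 - PowerSeries.C (4 * u) * PowerSeries.X)
      = PowerSeries.C (algebraMap ℂ A (1 / 4)) := by
  have h4 : algebraMap ℂ A (1 / 2) * algebraMap ℂ A (1 / 2) = algebraMap ℂ A (1 / 4) := by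
    rw [← map_mul]
    norm_num
  rw [mul_sub, mul_one, mul_left_comm]
  ext n
  cases n with
  | zero => simpa [dispersionlessLenard, evalDiff_lenard_zero] using h4
  | succ n =>
    rw [map_sub, PowerSeries.coeff_C_mul, PowerSeries.coeff_succ_mul_X,
      PowerSeries.coeff_mul, PowerSeries.coeff_mul]
    simp [dispersionlessLenard, sum_evalDiff_zero_lenard]

theorem derivative_dispersionlessLenard (u : A) :
    PowerSeries.derivative A (dispersionlessLenard u)
        * (1 - PowerSeries.C (4 * u) * PowerSeries.X)
      = PowerSeries.C (2 * u) * dispersionlessLenard u := by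
  set F := dispersionlessLenard u
  set E : PowerSeries A := 1 - PowerSeries.C (4 * u) * PowerSeries.X with hE
  set D := PowerSeries.derivative A
  have hF : F * F * E = PowerSeries.C (algebraMap ℂ A (1 / 4)) := dispersionlessLenard_mul_self u
  have hDE : D E = -(2 * PowerSeries.C (2 * u)) := by
    have h4 : 2 * PowerSeries.C (2 * u) = PowerSeries.C (4 * u) := by
      rw [← map_ofNat PowerSeries.C 2, ← map_mul, ← mul_assoc]
      norm_num
    rw [h4]
    simp [hE, D, -map_mul]
  have hFDF : 2 * F * (D F * E - PowerSeries.C (2 * u) * F) = 0 := by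
    have h := congrArg D hF
    simp only [D.leibniz, hDE, smul_eq_mul, D, PowerSeries.derivative_C] at h
    linear_combination h
  have h4 : 4 * PowerSeries.C (algebraMap ℂ A (1 / 4)) = 1 := by
    rw [← map_ofNat PowerSeries.C 4, ← map_mul, ← map_ofNat (algebraMap ℂ A) 4, ← map_mul]
    norm_num
  linear_combination 2 * F * E * hFDF
    - (D F * E - PowerSeries.C (2 * u) * F) * (4 * hF + h4)

theorem succ_mul_evalDiff_zero_lenard_succ (u : A) (n : ℕ) :
    (n + 1) * evalDiff 0 u (lenard (n + 1)) = 2 * (2 * n + 1) * u * evalDiff 0 u (lenard n) := by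
  have hcoeff : PowerSeries.coeff n
      (PowerSeries.derivative A (dispersionlessLenard u) * PowerSeries.X)
        = n * evalDiff 0 u (lenard n) := by
    cases n with
    | zero => simp
    | succ n =>
      rw [PowerSeries.coeff_succ_mul_X, PowerSeries.coeff_derivative, dispersionlessLenard,
        PowerSeries.coeff_mk, mul_comm, Nat.cast_succ]
  have h := congrArg (PowerSeries.coeff n) (derivative_dispersionlessLenard u)
  rw [mul_sub, mul_one, mul_left_comm, map_sub, PowerSeries.coeff_C_mul, hcoeff,
    PowerSeries.coeff_derivative, PowerSeries.coeff_C_mul, dispersionlessLenard,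
    PowerSeries.coeff_mk, PowerSeries.coeff_mk] at h
  linear_combination h

theorem evalDiff_zero_lenard (u : A) (n : ℕ) :
    evalDiff 0 u (lenard n) = algebraMap ℂ A (n.centralBinom / 2) * u ^ n := by
  induction n with
  | zero => simp [evalDiff_lenard_zero]
  | succ n ih =>
    have hbinom : ((n : A) + 1) * algebraMap ℂ A ((n + 1).centralBinom / 2)
        = 2 * (2 * n + 1) * algebraMap ℂ A (n.centralBinom / 2) := by
      have h : ((n : ℂ) + 1) * (n + 1).centralBinom = 2 * (2 * n + 1) * n.centralBinom :=
        mod_cast Nat.succ_mul_centralBinom_succ n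
      simpa [mul_div_assoc, map_ofNat (algebraMap ℂ A) 2] using
        congrArg (fun x => algebraMap ℂ A (x / 2)) h
    have hunit : IsUnit ((n : A) + 1) := by
      simpa using (IsUnit.mk0 _ n.cast_add_one_ne_zero).map (algebraMap ℂ A)
    refine hunit.mul_left_cancel ?_
    rw [succ_mul_evalDiff_zero_lenard_succ, ih]
    linear_combination -u ^ (n + 1) * hbinom

theorem hierarchyOp_zero (N : ℕ) (w : A) :
    hierarchyOp N 0 w = algebraMap ℂ A ((-1) ^ N * N.centralBinom) * w ^ (2 * N + 1) := by
  have h2 : (2 : A) * algebraMap ℂ A (1 / 2) = 1 := by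
    rw [← map_ofNat (algebraMap ℂ A) 2, ← map_mul]
    norm_num
  rw [hierarchyOp, Pi.zero_apply, Pi.zero_apply, zero_add, zero_sub,
    evalDiff_zero_lenard, div_eq_mul_one_div]
  simp only [map_mul, map_pow, map_neg, map_one, neg_pow (w ^ 2), ← pow_mul]
  linear_combination (w ^ (2 * N + 1) * (-1) ^ N * algebraMap ℂ A N.centralBinom) * h2

end DifferentialAlgebra

/-! ### Formal solutions at infinity, as power series in `1 / z` -/

section Expansion

variable {R S : Type*} [CommRing R] [Algebra ℂ R] [CommRing S] [Algebra ℂ S]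

/-- The derivation `δ d/dz` on power series in the variable `X = 1 / z`, so that
`d/dz = -X² d/dX`. -/
def invDeriv (δ : R) : Derivation ℂ (PowerSeries R) (PowerSeries R) :=
  (PowerSeries.C (-δ) * PowerSeries.X ^ 2) • (PowerSeries.derivative R).restrictScalars ℂ

theorem invDeriv_apply (δ : R) (f : PowerSeries R) :
    invDeriv δ f = PowerSeries.C (-δ) * PowerSeries.X ^ 2 * PowerSeries.derivative R f := rfl

theorem coeff_zero_invDeriv (δ : R) (f : PowerSeries R) :
    PowerSeries.coeff 0 (invDeriv δ f) = 0 := by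
  simp [invDeriv_apply]

theorem coeff_succ_invDeriv (δ : R) (f : PowerSeries R) (n : ℕ) :
    PowerSeries.coeff (n + 1) (invDeriv δ f) = -δ * (n * PowerSeries.coeff n f) := by
  rw [invDeriv_apply, mul_assoc, PowerSeries.coeff_C_mul, pow_two, mul_assoc,
    PowerSeries.coeff_succ_X_mul]
  cases n with
  | zero => simp
  | succ n =>
    rw [PowerSeries.coeff_succ_X_mul, PowerSeries.coeff_derivative,
      mul_comm (PowerSeries.coeff _ f), Nat.cast_succ]

theorem invDeriv_smul (c : ℂ) (δ : R) : invDeriv (c • δ) = c • invDeriv δ := by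
  ext f
  rw [Derivation.smul_apply, invDeriv_apply, invDeriv_apply, ← smul_neg, mul_assoc, mul_assoc]
  simp [Algebra.smul_def, PowerSeries.algebraMap_apply, mul_assoc]

theorem map_invDeriv (φ : R →ₐ[ℂ] S) (δ : R) (f : PowerSeries R) :
    PowerSeries.mapAlgHom φ (invDeriv δ f) = invDeriv (φ δ) (PowerSeries.mapAlgHom φ f) := by
  ext n
  cases n with
  | zero => simp [PowerSeries.mapAlgHom_apply, coeff_zero_invDeriv]
  | succ n => simp [PowerSeries.mapAlgHom_apply, coeff_succ_invDeriv]

theorem rescale_invDeriv (c δ : R) (f : PowerSeries R) :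
    PowerSeries.rescale c (invDeriv δ f) = invDeriv (c * δ) (PowerSeries.rescale c f) := by
  ext n
  cases n with
  | zero => simp [coeff_zero_invDeriv]
  | succ n =>
    rw [PowerSeries.coeff_rescale, coeff_succ_invDeriv, coeff_succ_invDeriv,
      PowerSeries.coeff_rescale]
    ring

theorem X_pow_dvd_invDeriv (δ : R) {k : ℕ} {f : PowerSeries R} (hf : PowerSeries.X ^ k ∣ f) :
    PowerSeries.X ^ k ∣ invDeriv δ f := by
  rw [PowerSeries.X_pow_dvd_iff] at hf ⊢
  intro n hn
  cases n with
  | zero => exact coeff_zero_invDeriv δ f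
  | succ n => rw [coeff_succ_invDeriv, hf n (by omega), mul_zero, mul_zero]

/-- The map `w ↦ ((δ d/dz + 2w) L_N[δ w' - w²] - β) / z`, whose fixed points are the solutions
decaying at infinity of the `N`-th equation with parameter `β` and with derivative scaled
by `δ`. -/
def hierarchyStep (N : ℕ) (β δ : R) (w : PowerSeries R) : PowerSeries R :=
  PowerSeries.X * (hierarchyOp N (invDeriv δ) w - PowerSeries.C β)

theorem X_pow_succ_dvd_hierarchyStep_sub (N : ℕ) (β δ : R) {k : ℕ} {v w : PowerSeries R}
    (hvw : PowerSeries.X ^ k ∣ v - w) :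
    PowerSeries.X ^ (k + 1) ∣ hierarchyStep N β δ v - hierarchyStep N β δ w := by
  simp only [hierarchyStep, ← mul_sub, sub_sub_sub_cancel_right, pow_succ']
  refine mul_dvd_mul_left _ (Ideal.mem_span_singleton.1 (hierarchyOp_sub_mem N ?_ ?_))
  · exact fun f hf => Ideal.mem_span_singleton.2 <|
      X_pow_dvd_invDeriv δ (Ideal.mem_span_singleton.1 hf)
  · exact Ideal.mem_span_singleton.2 hvw

theorem X_pow_dvd_sub_iterate {R : Type*} [CommRing R] {Φ : PowerSeries R → PowerSeries R}
    (hΦ : ∀ (k : ℕ) (v w : PowerSeries R),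
      PowerSeries.X ^ k ∣ v - w → PowerSeries.X ^ (k + 1) ∣ Φ v - Φ w)
    {w : PowerSeries R} (hw : Function.IsFixedPt Φ w) (v : PowerSeries R) (k : ℕ) :
    PowerSeries.X ^ k ∣ w - Φ^[k] v := by
  induction k with
  | zero => exact one_dvd _
  | succ k ih =>
    rw [Function.iterate_succ_apply']
    simpa only [hw.eq] using hΦ k _ _ ih

/-- The coefficient of `z ^ (-1 - (2N+1) l)` in the solution decaying at infinity of the `N`-th
equation with parameter `β` and with derivative scaled by `δ`. -/
def expansionCoeff (N l : ℕ) (β δ : R) : R :=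
  PowerSeries.coeff ((2 * N + 1) * l + 1) ((hierarchyStep N β δ)^[(2 * N + 1) * l + 2] 0)

theorem coeff_eq_expansionCoeff (N l : ℕ) {β δ : R} {w : PowerSeries R}
    (hw : Function.IsFixedPt (hierarchyStep N β δ) w) :
    PowerSeries.coeff ((2 * N + 1) * l + 1) w = expansionCoeff N l β δ := by
  have h := X_pow_dvd_sub_iterate (fun _ _ _ => X_pow_succ_dvd_hierarchyStep_sub N β δ) hw 0
    ((2 * N + 1) * l + 2)
  rw [PowerSeries.X_pow_dvd_iff] at h
  exact sub_eq_zero.1 (h _ (Nat.lt_succ_self _))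

theorem map_hierarchyStep (N : ℕ) (φ : R →ₐ[ℂ] S) (β δ : R) :
    Function.Semiconj (PowerSeries.mapAlgHom φ) (hierarchyStep N β δ)
      (hierarchyStep N (φ β) (φ δ)) := fun w => by
  rw [hierarchyStep, map_mul, map_sub, map_hierarchyOp N _ (map_invDeriv φ δ)]
  simp [hierarchyStep, PowerSeries.mapAlgHom_apply]

theorem map_expansionCoeff (N l : ℕ) (φ : R →ₐ[ℂ] S) (β δ : R) :
    φ (expansionCoeff N l β δ) = expansionCoeff N l (φ β) (φ δ) := by
  have h := ((map_hierarchyStep N φ β δ).iterate_right ((2 * N + 1) * l + 2)).eq 0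
  rw [map_zero] at h
  rw [expansionCoeff, expansionCoeff, ← h, PowerSeries.mapAlgHom_apply, PowerSeries.coeff_map]
  rfl

theorem rescale_hierarchyOp (N : ℕ) (c δ : ℂ) (w : PowerSeries ℂ) :
    PowerSeries.rescale c (hierarchyOp N (invDeriv δ) w)
      = hierarchyOp N (invDeriv (c * δ)) (PowerSeries.rescale c w) := by
  have hr : ⇑(PowerSeries.rescaleAlgHom c) = PowerSeries.rescale c :=
    congrArg DFunLike.coe (PowerSeries.coe_rescaleAlgHom c)
  rw [← hr, map_hierarchyOp N _ fun f => ?_]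
  simp only [hr, rescale_invDeriv]

/-- The scaling symmetry `z ↦ e^(2N) z`, `w ↦ e w` of the hierarchy. -/
theorem smul_rescale_hierarchyStep (N : ℕ) (e β δ : ℂ) :
    Function.Semiconj (fun w => e • PowerSeries.rescale (e ^ (2 * N)) w) (hierarchyStep N β δ)
      (hierarchyStep N (e ^ (2 * N + 1) * β) (e ^ (2 * N + 1) * δ)) := fun w => by
  have hd : invDeriv (e ^ (2 * N + 1) * δ) = e • invDeriv (e ^ (2 * N) * δ) := by
    rw [← invDeriv_smul, smul_eq_mul, pow_succ', mul_assoc]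
  have hC : PowerSeries.rescale (e ^ (2 * N)) (PowerSeries.C β) = PowerSeries.C β := by
    rw [← PowerSeries.coe_rescaleAlgHom]
    exact (PowerSeries.rescaleAlgHom (e ^ (2 * N))).commutes β
  change e • PowerSeries.rescale (e ^ (2 * N)) (hierarchyStep N β δ w)
    = hierarchyStep N _ _ (e • PowerSeries.rescale (e ^ (2 * N)) w)
  rw [hierarchyStep, hierarchyStep, hd, hierarchyOp_smul, ← rescale_hierarchyOp, map_mul, map_sub,
    PowerSeries.rescale_X, hC]
  simp only [PowerSeries.smul_eq_C_mul, map_mul, map_pow]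
  ring

theorem expansionCoeff_mul (N l : ℕ) (t β δ : ℂ) :
    expansionCoeff N l (t * β) (t * δ) = t ^ (2 * N * l + 1) * expansionCoeff N l β δ := by
  obtain ⟨e, rfl⟩ := IsAlgClosed.exists_pow_nat_eq t (Nat.succ_pos (2 * N))
  have h := ((smul_rescale_hierarchyStep N e β δ).iterate_right ((2 * N + 1) * l + 2)).eq 0
  rw [map_zero, smul_zero] at h
  rw [expansionCoeff, ← h, PowerSeries.coeff_smul, PowerSeries.coeff_rescale, smul_eq_mul,
    ← mul_assoc, ← pow_mul, ← pow_succ', ← pow_mul, expansionCoeff]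
  congr 2
  rw [Nat.succ_eq_add_one]
  ring

end Expansion

/-! ### The degree of the expansion coefficients in the parameter -/

/-- The map whose fixed point is the generating series `Z = 1 + X ^ m * Z ^ m` of the Fuss–Catalan
numbers. -/
def fussCatalanStep (m : ℕ) (Z : PowerSeries ℕ) : PowerSeries ℕ :=
  1 + PowerSeries.X ^ m * Z ^ m

theorem coeff_le_coeff_pow {f : PowerSeries ℕ} (hf : PowerSeries.constantCoeff f = 1) {n : ℕ}
    (hn : n ≠ 0) (j : ℕ) : PowerSeries.coeff j f ≤ PowerSeries.coeff j (f ^ n) := by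
  obtain ⟨n, rfl⟩ := Nat.exists_eq_succ_of_ne_zero hn
  have hterm := Finset.single_le_sum (f := fun ij : ℕ × ℕ =>
    PowerSeries.coeff ij.1 (f ^ n) * PowerSeries.coeff ij.2 f) (fun _ _ => Nat.zero_le _)
    (show (0, j) ∈ antidiagonal j by simp)
  rw [← PowerSeries.coeff_mul, ← pow_succ] at hterm
  simpa [hf] using hterm

theorem constantCoeff_fussCatalanStep {m : ℕ} (hm : m ≠ 0) (Z : PowerSeries ℕ) :
    PowerSeries.constantCoeff (fussCatalanStep m Z) = 1 := by
  simp [fussCatalanStep, hm]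

theorem coeff_iterate_fussCatalanStep_pos {m : ℕ} (hm : m ≠ 0) {l k : ℕ} (hlk : l < k) :
    0 < PowerSeries.coeff (m * l) ((fussCatalanStep m)^[k] 0) := by
  induction k generalizing l with
  | zero => exact absurd hlk l.not_lt_zero
  | succ k ih =>
    rw [Function.iterate_succ_apply']
    cases l with
    | zero =>
      rw [mul_zero, PowerSeries.coeff_zero_eq_constantCoeff_apply, constantCoeff_fussCatalanStep hm]
      exact one_pos
    | succ l =>
      have hk : PowerSeries.constantCoeff ((fussCatalanStep m)^[k] 0) = 1 := by
        obtain ⟨k, rfl⟩ := Nat.exists_eq_succ_of_ne_zero (by omega : k ≠ 0)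
        rw [Function.iterate_succ_apply', constantCoeff_fussCatalanStep hm]
      rw [fussCatalanStep, map_add, Nat.mul_succ, PowerSeries.coeff_X_pow_mul]
      exact Nat.add_pos_right _ ((ih (by omega)).trans_le (coeff_le_coeff_pow hk hm _))

theorem semiconj_fussCatalanStep_hierarchyStep (N : ℕ) {μ : ℂ}
    (hμ : μ ^ (2 * N + 1) = (-1) ^ N * N.centralBinom) :
    Function.Semiconj
      (fun Z => -(PowerSeries.X * PowerSeries.rescale μ (PowerSeries.map (Nat.castRingHom ℂ) Z)))
      (fussCatalanStep (2 * N + 1)) (hierarchyStep N (1 : ℂ) 0) := fun Z => by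
  have hd : ⇑(invDeriv (0 : ℂ)) = 0 := by
    ext f
    simp [invDeriv_apply]
  simp only [hierarchyStep, hd, hierarchyOp_zero, ← hμ, fussCatalanStep, map_add, map_mul, map_one,
    map_pow, PowerSeries.map_X, PowerSeries.rescale_X, PowerSeries.algebraMap_apply,
    Algebra.algebraMap_self, RingHom.id_apply, Odd.neg_pow ⟨N, rfl⟩]
  ring

theorem expansionCoeff_one_zero_ne_zero (N l : ℕ) : expansionCoeff N l (1 : ℂ) 0 ≠ 0 := by
  have hbinom : (-1) ^ N * (N.centralBinom : ℂ) ≠ 0 :=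
    mul_ne_zero (pow_ne_zero _ (neg_ne_zero.2 one_ne_zero))
      (Nat.cast_ne_zero.2 N.centralBinom_ne_zero)
  obtain ⟨μ, hμ⟩ := IsAlgClosed.exists_pow_nat_eq ((-1) ^ N * (N.centralBinom : ℂ))
    (Nat.succ_pos (2 * N))
  have hμ0 : μ ≠ 0 := ne_zero_pow (Nat.succ_ne_zero (2 * N)) (hμ ▸ hbinom)
  have h := ((semiconj_fussCatalanStep_hierarchyStep N hμ).iterate_right
    ((2 * N + 1) * l + 2)).eq 0
  simp only [map_zero, mul_zero, neg_zero] at h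
  rw [expansionCoeff, ← h, map_neg, PowerSeries.coeff_succ_X_mul, PowerSeries.coeff_rescale,
    PowerSeries.coeff_map, neg_ne_zero]
  refine mul_ne_zero (pow_ne_zero _ hμ0) (Nat.cast_ne_zero.2 (Nat.pos_iff_ne_zero.1 ?_))
  exact coeff_iterate_fussCatalanStep_pos (Nat.succ_ne_zero (2 * N)) (by nlinarith)

theorem natDegree_eq_of_eval_eq_pow_mul_eval_inv {K : Type*} [Field K] [Infinite K] {p q : K[X]}
    {M : ℕ} (hpq : ∀ x ≠ 0, p.eval x = x ^ M * q.eval x⁻¹) (hq : q.coeff 0 ≠ 0) :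
    p.natDegree = M := by
  have hq0 : q ≠ 0 := fun h => hq (by rw [h, coeff_zero])
  have hrev : p * X ^ q.natDegree = q.reverse * X ^ M := by
    refine eq_of_infinite_eval_eq _ _ ((Set.finite_singleton 0).infinite_compl.mono ?_)
    intro x (hx : x ≠ 0)
    let _ : Invertible x⁻¹ := invertibleOfNonzero (inv_ne_zero hx)
    have h := eval₂_reverse_mul_pow (RingHom.id K) x⁻¹ q
    rw [invOf_eq_inv, inv_inv, eval₂_id, eval₂_id, inv_pow] at h
    have hcancel : x ^ q.natDegree * (x ^ q.natDegree)⁻¹ = 1 := mul_inv_cancel₀ (pow_ne_zero _ hx)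
    simp only [Set.mem_ofPred_eq, eval_mul, eval_pow, eval_X]
    rw [hpq x hx, ← h]
    linear_combination (x ^ M * q.reverse.eval x) * hcancel
  have hp0 : p ≠ 0 := by
    rintro rfl
    rw [zero_mul] at hrev
    exact mul_ne_zero (reverse_eq_zero.not.2 hq0) (pow_ne_zero M X_ne_zero) hrev.symm
  have hdeg := congrArg natDegree hrev
  rw [natDegree_mul_X_pow _ hp0, natDegree_mul_X_pow _ (reverse_eq_zero.not.2 hq0),
    reverse_natDegree, natTrailingDegree_eq_zero.2 (Or.inr hq), Nat.sub_zero, add_comm] at hdeg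
  exact Nat.add_left_cancel hdeg

theorem eval_expansionCoeff (N l : ℕ) (β δ : ℂ[X]) (x : ℂ) :
    (expansionCoeff N l β δ).eval x = expansionCoeff N l (β.eval x) (δ.eval x) := by
  simpa only [coe_aeval_eq_eval] using map_expansionCoeff N l (aeval x : ℂ[X] →ₐ[ℂ] ℂ) β δ

theorem natDegree_expansionCoeff (N l : ℕ) :
    (expansionCoeff N l (X : ℂ[X]) 1).natDegree = 2 * N * l + 1 := by
  refine natDegree_eq_of_eval_eq_pow_mul_eval_inv (q := expansionCoeff N l 1 X) (fun x hx => ?_) ?_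
  · rw [eval_expansionCoeff, eval_expansionCoeff, ← expansionCoeff_mul, eval_one, eval_one, eval_X,
      eval_X, mul_one, mul_inv_cancel₀ hx]
  · rw [coeff_zero_eq_eval_zero, eval_expansionCoeff, eval_one, eval_X]
    exact expansionCoeff_one_zero_ne_zero N l

theorem expansionCoeff_zero {R : Type*} [CommRing R] [Algebra ℂ R] (N : ℕ) (β δ : R) :
    expansionCoeff N 0 β δ = -β := by
  have hstep (w : PowerSeries R) : PowerSeries.constantCoeff (hierarchyStep N β δ w) = 0 := by
    simp [hierarchyStep]
  have hop {w : PowerSeries R} (hw : PowerSeries.constantCoeff w = 0) :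
      PowerSeries.constantCoeff (hierarchyOp N (invDeriv δ) w) = 0 := by
    simp [hierarchyOp, invDeriv_apply, hw]
  rw [expansionCoeff, mul_zero, zero_add, zero_add, Function.iterate_succ_apply', hierarchyStep,
    ← zero_add 1, PowerSeries.coeff_succ_X_mul, PowerSeries.coeff_zero_eq_constantCoeff_apply,
    map_sub, PowerSeries.constantCoeff_C, Function.iterate_one, hop (hstep 0), zero_sub]

/-! ### Laurent expansions at infinity -/

/-- The derivation `single k a ↦ single k (χ k * a)` of Hahn series given by an additive
character `χ` of the group of exponents. -/
def weightDeriv {Γ R : Type*} [AddCommMonoid Γ] [PartialOrder Γ] [IsOrderedCancelAddMonoid Γ]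
    [CommRing R] (χ : Γ →+ R) : Derivation R (HahnSeries Γ R) (HahnSeries Γ R) :=
  have hsupp (f : HahnSeries Γ R) : (fun k => χ k * f.coeff k).support ⊆ f.support :=
    fun _ hk => right_ne_zero_of_mul hk
  Derivation.mk'
    { toFun f := ⟨fun k => χ k * f.coeff k, f.isPWO_support.mono (hsupp f)⟩
      map_add' f g := by
        ext k
        simp [mul_add]
      map_smul' c f := by
        ext k
        simp [mul_left_comm] }
    fun f g => by
      ext k
      simp only [LinearMap.coe_mk, AddHom.coe_mk, smul_eq_mul, HahnSeries.coeff_add]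
      rw [mul_comm g, HahnSeries.coeff_mul, HahnSeries.coeff_mul_right' g.isPWO_support,
        HahnSeries.coeff_mul_left' f.isPWO_support, Finset.mul_sum, ← Finset.sum_add_distrib]
      rotate_left
      · exact hsupp f
      · exact hsupp g
      refine Finset.sum_congr rfl fun ij hij => ?_
      rw [← (Finset.mem_antidiagonal.1 hij).2.2, map_add]
      ring

/-- The differential ring given by a derivation over an arbitrary ring of constants. -/
abbrev differentialOfDerivation {R A : Type*} [CommRing R] [CommRing A] [Algebra R A]
    (d : Derivation R A A) : Differential A :=
  ⟨d.restrictScalars ℤ⟩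

section LaurentExpansion

/-- The coefficientwise algebra structure, which must take precedence over the one induced by
power series. -/
local instance (priority := 2000) laurentAlgebra : Algebra ℂ (LaurentSeries ℂ) :=
  HahnSeries.instAlgebra

/-- The derivation `d/dz` on Laurent series in `1 / z`. -/
def laurentDeriv : Derivation ℂ (LaurentSeries ℂ) (LaurentSeries ℂ) :=
  (HahnSeries.single (1 : ℤ) (1 : ℂ) : LaurentSeries ℂ) • weightDeriv (-Int.castAddHom ℂ)

/-- Makes `Differential.logDeriv` the logarithmic derivative with respect to `z`. -/
local instance laurentDifferential : Differential (LaurentSeries ℂ) :=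
  differentialOfDerivation laurentDeriv

theorem coeff_laurentDeriv (f : LaurentSeries ℂ) (k : ℤ) :
    (laurentDeriv f).coeff k = -((k - 1 : ℤ) : ℂ) * f.coeff (k - 1) := by
  change (HahnSeries.single (1 : ℤ) (1 : ℂ) * weightDeriv (-Int.castAddHom ℂ) f).coeff k = _
  rw [HahnSeries.coeff_single_mul, one_mul]
  rfl

/-- The inclusion of power series in `1 / z` into Laurent series in `1 / z`. -/
def toLaurent : PowerSeries ℂ →ₐ[ℂ] LaurentSeries ℂ := HahnSeries.ofPowerSeriesAlg ℤ ℂ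

theorem toLaurent_injective : Function.Injective toLaurent :=
  HahnSeries.ofPowerSeries_injective (Γ := ℤ) (R := ℂ)

theorem toLaurent_C (a : ℂ) : toLaurent (PowerSeries.C a) = algebraMap ℂ (LaurentSeries ℂ) a :=
  toLaurent.commutes a

theorem coeff_toLaurent (f : PowerSeries ℂ) (k : ℤ) :
    (toLaurent f).coeff k = if k < 0 then 0 else PowerSeries.coeff k.natAbs f :=
  PowerSeries.coeff_coe f k

theorem toLaurent_invDeriv : Function.Semiconj toLaurent (invDeriv 1) laurentDeriv := fun f => by
  ext k
  rw [coeff_laurentDeriv, coeff_toLaurent, coeff_toLaurent]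
  rcases lt_or_ge k 0 with hk | hk
  · rw [if_pos hk, if_pos (by omega), mul_zero]
  · obtain ⟨n, rfl⟩ := Int.eq_ofNat_of_zero_le hk
    cases n with
    | zero => simpa using coeff_zero_invDeriv 1 f
    | succ n =>
      rw [if_neg hk.not_gt, Int.natAbs_natCast, coeff_succ_invDeriv, Nat.cast_succ,
        add_sub_cancel_right, if_neg (Int.natCast_nonneg n).not_gt, Int.natAbs_natCast,
        Int.cast_natCast, neg_one_mul, neg_mul]

theorem single_neg_one_mul_toLaurent_X :
    (HahnSeries.single (-1) 1 : LaurentSeries ℂ) * toLaurent PowerSeries.X = 1 := by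
  rw [show toLaurent PowerSeries.X = HahnSeries.single 1 1 from HahnSeries.ofPowerSeries_X,
    HahnSeries.single_mul_single]
  simp

/-- The expansion at infinity of a polynomial. -/
def polyExpansion : ℂ[X] →ₐ[ℂ] LaurentSeries ℂ := aeval (HahnSeries.single (-1) 1)

theorem coeff_polyExpansion (P : ℂ[X]) (k : ℕ) :
    (polyExpansion P).coeff (-(k : ℤ)) = P.coeff k := by
  induction P using Polynomial.induction_on' with
  | add p q hp hq => rw [map_add, HahnSeries.coeff_add, hp, hq, coeff_add]
  | monomial n a =>
    rw [polyExpansion, aeval_monomial, HahnSeries.single_pow, one_pow, ← Algebra.smul_def,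
      HahnSeries.coeff_smul, HahnSeries.coeff_single, coeff_monomial]
    by_cases h : n = k
    · simp [h]
    · rw [if_neg h, if_neg (by simp; omega), smul_zero]

theorem polyExpansion_injective : Function.Injective polyExpansion := by
  intro P Q h
  ext k
  rw [← coeff_polyExpansion, h, coeff_polyExpansion]

theorem polyExpansion_ne_zero {P : ℂ[X]} (hP : P ≠ 0) : polyExpansion P ≠ 0 :=
  (map_ne_zero_iff _ polyExpansion_injective).2 hP

theorem laurentDeriv_single_neg_one : laurentDeriv (HahnSeries.single (-1) 1) = 1 := by
  ext k
  rw [coeff_laurentDeriv, HahnSeries.coeff_single, HahnSeries.coeff_one]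
  by_cases h : k = 0
  · simp [h]
  · rw [if_neg h, if_neg (by omega), mul_zero]

theorem polyExpansion_derivative (P : ℂ[X]) :
    polyExpansion (derivative P) = laurentDeriv (polyExpansion P) := by
  rw [polyExpansion, Derivation.map_aeval, laurentDeriv_single_neg_one, smul_eq_mul, mul_one]

/-- The expansion at infinity of a rational function. -/
def expansion : RatFunc ℂ →ₐ[ℂ] LaurentSeries ℂ :=
  RatFunc.liftAlgHom polyExpansion
    (nonZeroDivisors_le_comap_nonZeroDivisors_of_injective _ polyExpansion_injective)

theorem expansion_algebraMap (P : ℂ[X]) :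
    expansion (algebraMap ℂ[X] (RatFunc ℂ) P) = polyExpansion P := by
  have h := RatFunc.liftAlgHom_apply_div polyExpansion
    (nonZeroDivisors_le_comap_nonZeroDivisors_of_injective _ polyExpansion_injective) P 1
  rwa [map_one, map_one, div_one, div_one] at h

theorem expansion_ratDeriv : Function.Semiconj expansion ratDeriv laurentDeriv := fun f => by
  have hd := polyExpansion_ne_zero f.denom_ne_zero
  conv_rhs => rw [← RatFunc.num_div_denom f]
  rw [ratDeriv, map_div₀, map_div₀, map_pow, expansion_algebraMap, expansion_algebraMap,
    expansion_algebraMap, Derivation.leibniz_div, map_sub, map_mul, map_mul,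
    polyExpansion_derivative, polyExpansion_derivative]
  simp only [smul_eq_mul]
  field_simp

theorem expansion_painleveTwo (N : ℕ) (w : RatFunc ℂ) (α : ℂ) :
    expansion (painleveTwo N w α) = hierarchyOp N laurentDeriv (expansion w)
      - HahnSeries.single (-1) 1 * expansion w - algebraMap ℂ (LaurentSeries ℂ) α := by
  have hX : expansion RatFunc.X = HahnSeries.single (-1) 1 := by
    rw [← RatFunc.algebraMap_X, expansion_algebraMap, polyExpansion, aeval_X]
  have hC : expansion (RatFunc.C α) = algebraMap ℂ (LaurentSeries ℂ) α := by
    rw [← RatFunc.algebraMap_C, expansion_algebraMap, polyExpansion, aeval_C]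
  change expansion (hierarchyOp N ratDeriv w - RatFunc.X * w - RatFunc.C α) = _
  rw [map_sub, map_sub, map_mul, map_hierarchyOp N _ expansion_ratDeriv, hX, hC]

theorem isFixedPt_hierarchyStep_of_painleveTwo_eq_zero {N : ℕ} {w : RatFunc ℂ} {α : ℂ}
    (hw : painleveTwo N w α = 0) {f : PowerSeries ℂ} (hf : expansion w = toLaurent f) :
    Function.IsFixedPt (hierarchyStep N α 1) f := by
  have h := expansion_painleveTwo N w α
  rw [hw, map_zero, hf, ← map_hierarchyOp N _ toLaurent_invDeriv] at h
  refine toLaurent_injective ?_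
  rw [hierarchyStep, map_mul, map_sub, toLaurent_C]
  linear_combination toLaurent f * single_neg_one_mul_toLaurent_X - toLaurent PowerSeries.X * h

/-! ### The logarithmic derivative and the power sums of the roots -/

theorem mk_pow_mul_one_sub {R : Type*} [CommRing R] (a : R) :
    PowerSeries.mk (fun m => a ^ m) * (1 - PowerSeries.C a * PowerSeries.X) = 1 := by
  simpa [PowerSeries.rescale_mk] using
    congrArg (PowerSeries.rescale a) (PowerSeries.mk_one_mul_one_sub_eq_one R)

theorem logDeriv_polyExpansion_X_sub_C (a : ℂ) :
    Differential.logDeriv (polyExpansion (X - C a))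
      = toLaurent (PowerSeries.X * PowerSeries.mk fun m => a ^ m) := by
  have hC : polyExpansion (C a) = algebraMap ℂ (LaurentSeries ℂ) a := polyExpansion.commutes a
  have hderiv : laurentDeriv (polyExpansion (X - C a)) = 1 := by
    rw [← polyExpansion_derivative, derivative_X_sub_C, map_one]
  have hgeom := congrArg toLaurent (mk_pow_mul_one_sub a)
  refine (div_eq_iff (polyExpansion_ne_zero (X_sub_C_ne_zero a))).2 (hderiv.trans ?_)
  rw [map_sub, hC, ← toLaurent_C, polyExpansion, aeval_X]
  simp only [map_mul, map_sub, map_one] at hgeom ⊢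
  linear_combination
    -hgeom - toLaurent (PowerSeries.mk fun m => a ^ m) * single_neg_one_mul_toLaurent_X

/-- The generating series `∑ s_m / z ^ (m + 1)` of the power sums of the roots of `P`. -/
def powerSumSeries (P : ℂ[X]) : PowerSeries ℂ :=
  PowerSeries.X * PowerSeries.mk fun m => rootPowerSum P m

theorem powerSumSeries_eq_sum (P : ℂ[X]) :
    powerSumSeries P
      = (P.roots.map fun a => PowerSeries.X * PowerSeries.mk fun m => a ^ m).sum := by
  rw [powerSumSeries, Multiset.sum_map_mul_left]
  congr 1
  ext m
  rw [PowerSeries.coeff_mk, map_multiset_sum, Multiset.map_map, rootPowerSum]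
  simp only [Function.comp_apply, PowerSeries.coeff_mk]

theorem logDeriv_polyExpansion {P : ℂ[X]} (hP : P ≠ 0) :
    Differential.logDeriv (polyExpansion P) = toLaurent (powerSumSeries P) := by
  have hlead : C P.leadingCoeff ≠ 0 := C_ne_zero.2 (leadingCoeff_ne_zero.2 hP)
  have hprod : (P.roots.map fun a => X - C a).prod ≠ 0 :=
    (monic_multiset_prod_of_monic _ _ fun a _ => monic_X_sub_C a).ne_zero
  have hconst : Differential.logDeriv (polyExpansion (C P.leadingCoeff)) = 0 :=
    (Differential.logDeriv_eq_zero _).2 <| (polyExpansion_derivative _).symm.trans (by simp)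
  conv_lhs => rw [(IsAlgClosed.splits P).eq_prod_roots]
  rw [map_mul, Differential.logDeriv_mul _ _ (polyExpansion_ne_zero hlead)
      (polyExpansion_ne_zero hprod), hconst, zero_add, map_multiset_prod, Multiset.map_map,
    Differential.logDeriv_multisetProd (f := polyExpansion ∘ fun a => X - C a) _
      fun a _ => polyExpansion_ne_zero (X_sub_C_ne_zero a),
    powerSumSeries_eq_sum, map_multiset_sum, Multiset.map_map]
  simp only [Function.comp_apply, logDeriv_polyExpansion_X_sub_C]

theorem expansion_logDerivQuot {P Q : ℂ[X]} (hP : P ≠ 0) (hQ : Q ≠ 0) :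
    expansion (logDerivQuot P Q) = toLaurent (powerSumSeries P - powerSumSeries Q) := by
  rw [map_sub, ← logDeriv_polyExpansion hP, ← logDeriv_polyExpansion hQ,
    ← Differential.logDeriv_div _ _ (polyExpansion_ne_zero hP) (polyExpansion_ne_zero hQ),
    logDerivQuot, map_div₀, expansion_ratDeriv.eq, map_div₀, expansion_algebraMap,
    expansion_algebraMap]
  rfl

theorem rootPowerSum_sub {N : ℕ} {P Q : ℂ[X]} (hP : P ≠ 0) (hQ : Q ≠ 0) {α : ℂ}
    (hw : painleveTwo N (logDerivQuot P Q) α = 0) (l : ℕ) :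
    rootPowerSum P ((2 * N + 1) * l) - rootPowerSum Q ((2 * N + 1) * l)
      = expansionCoeff N l α 1 := by
  rw [← coeff_eq_expansionCoeff N l
      (isFixedPt_hierarchyStep_of_painleveTwo_eq_zero hw (expansion_logDerivQuot hP hQ)),
    powerSumSeries, powerSumSeries, ← mul_sub, PowerSeries.coeff_succ_X_mul, map_sub,
    PowerSeries.coeff_mk, PowerSeries.coeff_mk]

end LaurentExpansion

/-! ### Newton's identities -/

theorem exists_fin_map_univ_eq {α : Type*} {n : ℕ} {s : Multiset α} (hs : s.card = n) :
    ∃ f : Fin n → α, Finset.univ.val.map f = s := by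
  obtain ⟨l, rfl⟩ := Quot.exists_rep s
  obtain rfl : l.length = n := hs
  exact ⟨l.get, (Fin.univ_val_map _).trans (congrArg _ (List.ofFn_get l))⟩

theorem aeval_psum {σ A R : Type*} [Fintype σ] [CommSemiring A] [CommSemiring R] [Algebra A R]
    (f : σ → R) (m : ℕ) :
    MvPolynomial.aeval f (MvPolynomial.psum σ A m)
      = ((Finset.univ.val.map f).map fun a => a ^ m).sum := by
  simp [MvPolynomial.psum, Finset.sum_map_val]

theorem mul_esymm_add_sum_esymm_mul_sum_map_pow {R : Type*} [CommRing R] (s : Multiset R) (k : ℕ) :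
    k * ((-1) ^ k * s.esymm k)
      + ∑ i ∈ Finset.range k, (-1) ^ i * s.esymm i * (s.map fun a => a ^ (k - i)).sum = 0 := by
  obtain ⟨f, hf⟩ := exists_fin_map_univ_eq (s := s) rfl
  have h := MvPolynomial.mul_esymm_eq_sum (Fin s.card) R k
  rw [Finset.sum_filter, Finset.Nat.sum_antidiagonal_eq_sum_range_succ_mk, Finset.sum_range_succ,
    if_neg (lt_irrefl k), add_zero,
    Finset.sum_congr rfl fun i hi => if_pos (Finset.mem_range.1 hi)] at h
  replace h := congrArg (MvPolynomial.aeval f) h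
  simp only [map_mul, map_sum, map_natCast, map_pow, map_neg, map_one,
    MvPolynomial.aeval_esymm_eq_multiset_esymm, aeval_psum, hf] at h
  have hsign : ((-1) ^ k * (-1) ^ k : R) = 1 := by
    rw [← mul_pow, neg_one_mul, neg_neg, one_pow]
  rw [mul_left_comm, h, pow_succ, ← mul_assoc, ← mul_assoc, hsign, one_mul, neg_one_mul,
    neg_add_cancel]

theorem esymm_eq_zero_of_card_lt {R : Type*} [CommSemiring R] {s : Multiset R} {k : ℕ}
    (hk : s.card < k) : s.esymm k = 0 := by
  rw [Multiset.esymm, Multiset.powersetCard_eq_empty _ hk, Multiset.map_zero, Multiset.sum_zero]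

theorem coeff_natDegree_sub_eq_esymm_roots {K : Type*} [Field K] [IsAlgClosed K] {P : K[X]}
    (hP : P.Monic) {k : ℕ} (hk : k ≤ P.natDegree) :
    P.coeff (P.natDegree - k) = (-1) ^ k * P.roots.esymm k := by
  rw [coeff_eq_esymm_roots_of_card (splits_iff_card_roots.1 (IsAlgClosed.splits P))
    (Nat.sub_le _ _), hP.leadingCoeff, one_mul, Nat.sub_sub_self hk]

theorem newton_identity {P : ℂ[X]} (hP : P.Monic) {k : ℕ} (hk : k ≤ P.natDegree) :
    k * P.coeff (P.natDegree - k)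
      + ∑ j ∈ Finset.Icc 1 k, rootPowerSum P j * P.coeff (P.natDegree - (k - j)) = 0 := by
  rw [coeff_natDegree_sub_eq_esymm_roots hP hk, ← mul_esymm_add_sum_esymm_mul_sum_map_pow P.roots k]
  congr 1
  refine Finset.sum_nbij' (k - ·) (k - ·) ?_ ?_ ?_ ?_ fun j hj => ?_
  any_goals simp only [Finset.mem_Icc, Finset.mem_range]; omega
  rw [coeff_natDegree_sub_eq_esymm_roots hP (by omega), Nat.sub_sub_self (Finset.mem_Icc.1 hj).2,
    mul_comm]
  rfl

theorem newton_identity_of_lt {P : ℂ[X]} (hP : P.Monic) {m : ℕ} (hm : P.natDegree < m) :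
    rootPowerSum P m
      + ∑ j ∈ Finset.Icc 1 P.natDegree,
          P.coeff (P.natDegree - j) * rootPowerSum P (m - j) = 0 := by
  have hvanish {i : ℕ} (hi : P.natDegree < i) : P.roots.esymm i = 0 :=
    esymm_eq_zero_of_card_lt (P.card_roots'.trans_lt hi)
  have hsum : ∑ i ∈ Finset.range (P.natDegree + 1),
      P.coeff (P.natDegree - i) * rootPowerSum P (m - i) = 0 := by
    rw [← mul_esymm_add_sum_esymm_mul_sum_map_pow P.roots m, hvanish hm, mul_zero, mul_zero,
      zero_add, ← Finset.sum_subset (Finset.range_subset_range.2 hm) fun i _ hi => by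
        rw [hvanish (by simpa using hi), mul_zero, zero_mul]]
    refine Finset.sum_congr rfl fun i hi => ?_
    rw [coeff_natDegree_sub_eq_esymm_roots hP (Finset.mem_range_succ_iff.1 hi)]
    rfl
  rwa [Finset.range_eq_Ico, Finset.sum_eq_sum_Ico_succ_bot (Nat.succ_pos _), Nat.sub_zero,
    hP.coeff_natDegree, one_mul, Nat.sub_zero] at hsum

theorem esymm_mem_adjoin_psum (σ R : Type*) [Fintype σ] [CommRing R] [Algebra ℚ R] (k : ℕ) :
    MvPolynomial.esymm σ R k ∈ Algebra.adjoin R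
      (Set.range fun i : Fin (Fintype.card σ) => MvPolynomial.psum σ R (i + 1)) := by
  set 𝒜 := Algebra.adjoin R
    (Set.range fun i : Fin (Fintype.card σ) => MvPolynomial.psum σ R (i + 1))
  induction k using Nat.strong_induction_on with
  | _ k ih =>
    rcases Nat.eq_zero_or_pos k with rfl | hk
    · rw [MvPolynomial.esymm_zero]
      exact 𝒜.one_mem
    rcases lt_or_ge (Fintype.card σ) k with hlt | hle
    · rw [MvPolynomial.esymm, Finset.powersetCard_eq_empty.2 hlt, Finset.sum_empty]
      exact 𝒜.zero_mem
    have hmul : (k : MvPolynomial σ R) * MvPolynomial.esymm σ R k ∈ 𝒜 := by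
      rw [MvPolynomial.mul_esymm_eq_sum]
      refine 𝒜.mul_mem (𝒜.pow_mem (𝒜.neg_mem 𝒜.one_mem) _) (𝒜.sum_mem fun ij hij => ?_)
      obtain ⟨hij, hlt⟩ := Finset.mem_filter.1 hij
      rw [Finset.HasAntidiagonal.mem_antidiagonal] at hij
      refine 𝒜.mul_mem (𝒜.mul_mem (𝒜.pow_mem (𝒜.neg_mem 𝒜.one_mem) _) (ih _ hlt))
        (Algebra.subset_adjoin ⟨⟨ij.2 - 1, by omega⟩, ?_⟩)
      exact congrArg (MvPolynomial.psum σ R) (Nat.sub_add_cancel (by omega))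
    have hinv : algebraMap ℚ R (k : ℚ)⁻¹ * (k : R) = 1 := by
      rw [← map_natCast (algebraMap ℚ R), ← map_mul,
        inv_mul_cancel₀ (Nat.cast_ne_zero.2 hk.ne'), map_one]
    convert 𝒜.smul_mem hmul (algebraMap ℚ R (k : ℚ)⁻¹) using 1
    rw [← nsmul_eq_mul, ← Nat.cast_smul_eq_nsmul R, smul_smul, hinv, one_smul]

theorem mem_adjoin_psum_of_isSymmetric {σ R : Type*} [Fintype σ] [CommRing R] [Algebra ℚ R]
    {p : MvPolynomial σ R} (hp : p.IsSymmetric) :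
    p ∈ Algebra.adjoin R
      (Set.range fun i : Fin (Fintype.card σ) => MvPolynomial.psum σ R (i + 1)) := by
  obtain ⟨q, hq⟩ := MvPolynomial.esymmAlgHom_surjective (σ := σ) R le_rfl ⟨p, hp⟩
  obtain rfl := (MvPolynomial.esymmAlgHom_apply q).symm.trans (congrArg Subtype.val hq)
  refine Algebra.adjoin_le ?_ <| (Algebra.adjoin_range_eq_range_aeval R
    fun i : Fin (Fintype.card σ) => MvPolynomial.esymm σ R (i + 1)).ge ⟨q, rfl⟩
  rintro _ ⟨i, rfl⟩
  exact esymm_mem_adjoin_psum σ R (i + 1)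

theorem exists_sum_map_pow_eq_aeval {A : Type*} (R : Type*) [CommRing A] [Algebra ℚ A]
    [CommRing R] [Algebra A R] (p m : ℕ) :
    ∃ F : MvPolynomial (Fin p) A, ∀ s : Multiset R, s.card = p →
      (s.map fun a => a ^ m).sum
        = MvPolynomial.aeval (fun i : Fin p => (s.map fun a => a ^ (i + 1 : ℕ)).sum) F := by
  have hmem := mem_adjoin_psum_of_isSymmetric (MvPolynomial.psum_isSymmetric (Fin p) A m)
  rw [Fintype.card_fin, Algebra.adjoin_range_eq_range_aeval] at hmem
  obtain ⟨F, hF : MvPolynomial.aeval (fun i : Fin p => MvPolynomial.psum (Fin p) A (i + 1)) F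
    = MvPolynomial.psum (Fin p) A m⟩ := hmem
  refine ⟨F, fun s hs => ?_⟩
  obtain ⟨f, rfl⟩ := exists_fin_map_univ_eq hs
  rw [← aeval_psum (A := A), ← hF, MvPolynomial.comp_aeval_apply]
  simp only [aeval_psum]

/-! ### The power sums as polynomials in `n` -/

section Faulhaber

variable {K : Type*} [Field K] [Algebra ℚ K]

/-- The polynomial whose value at `n` is `∑ k < n, p(k)`, given by Faulhaber's formula. -/
def faulhaber (p : K[X]) : K[X] :=
  p.sum fun i a => C (a / (i + 1)) *
    (Polynomial.bernoulli (i + 1) - C (_root_.bernoulli (i + 1))).map (algebraMap ℚ K)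

theorem eval_faulhaber (p : K[X]) (n : ℕ) :
    (faulhaber p).eval (n : K) = ∑ k ∈ Finset.range n, p.eval (k : K) := by
  have := algebraRat.charZero K
  have hterm (i : ℕ) (a : K) : eval (n : K) (C (a / (i + 1)) *
      (Polynomial.bernoulli (i + 1) - C (_root_.bernoulli (i + 1))).map (algebraMap ℚ K))
        = ∑ k ∈ Finset.range n, a * (k : K) ^ i := by
    rw [eval_mul, eval_C, eval_natCast_map, eval_sub, eval_C, ← Nat.succ_eq_add_one,
      ← sum_range_pow_eq_bernoulli_sub, ← Finset.mul_sum]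
    simp only [map_mul, map_add, map_natCast, map_one, map_sum, map_pow]
    rw [← mul_assoc, div_mul_cancel₀ _ (Nat.cast_add_one_ne_zero i)]
  rw [faulhaber, Polynomial.sum, eval_finsetSum, Finset.sum_congr rfl fun i _ => hterm i _,
    Finset.sum_comm]
  simp only [eval_eq_sum, Polynomial.sum]

theorem natDegree_faulhaber {p : K[X]} (hp : p ≠ 0) :
    (faulhaber p).natDegree = p.natDegree + 1 := by
  have := algebraRat.charZero K
  have hcoeff (i j : ℕ) : ((Polynomial.bernoulli (i + 1)
      - C (_root_.bernoulli (i + 1))).map (algebraMap ℚ K)).coeff (j + 1)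
        = if j ≤ i then algebraMap ℚ K (_root_.bernoulli (i - j) * (i + 1).choose (j + 1))
          else 0 := by
    rw [coeff_map, coeff_sub, coeff_C_succ, sub_zero, coeff_bernoulli]
    simp only [add_le_add_iff_right, Nat.add_sub_add_right, apply_ite (algebraMap ℚ K), map_zero]
  refine natDegree_eq_of_le_of_coeff_ne_zero (natDegree_le_iff_coeff_eq_zero.2 fun j hj => ?_) ?_
  · obtain ⟨j, rfl⟩ := Nat.exists_eq_succ_of_ne_zero hj.ne_bot
    rw [faulhaber, Polynomial.sum, finsetSum_coeff]
    refine Finset.sum_eq_zero fun i hi => ?_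
    have hi := le_natDegree_of_mem_supp i hi
    rw [coeff_C_mul, Nat.succ_eq_add_one, hcoeff, if_neg (by omega), mul_zero]
  · rw [faulhaber, Polynomial.sum, finsetSum_coeff,
      Finset.sum_eq_single_of_mem _ (natDegree_mem_support_of_nonzero hp) fun i hi hne => ?_,
      coeff_C_mul, hcoeff, if_pos le_rfl]
    · simpa using ⟨hp, Nat.cast_add_one_ne_zero p.natDegree⟩
    · have hi := le_natDegree_of_mem_supp i hi
      rw [coeff_C_mul, hcoeff, if_neg (by omega), mul_zero]

end Faulhaber

theorem IsYablonskiiVorobev.monic {N n : ℕ} {Q : ℂ[X]} (h : IsYablonskiiVorobev N n Q) :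
    Q.Monic := by
  cases h with
  | zero => exact monic_one
  | succ _ hQ _ => exact hQ

theorem IsYablonskiiVorobev.rootPowerSum_eq {N n : ℕ} {Q : ℂ[X]} (h : IsYablonskiiVorobev N n Q)
    (l : ℕ) :
    rootPowerSum Q ((2 * N + 1) * l)
      = -∑ k ∈ Finset.range n, expansionCoeff N l ((k : ℂ) + 1) 1 := by
  induction h with
  | zero => simp [rootPowerSum]
  | succ hP hQ hw ih =>
    have hsub := rootPowerSum_sub hP.monic.ne_zero hQ.ne_zero hw l
    rw [Nat.cast_succ] at hsub
    rw [Finset.sum_range_succ]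
    linear_combination ih - hsub

theorem rootPowerSum_zero (P : ℂ[X]) : rootPowerSum P 0 = P.natDegree := by
  simp [rootPowerSum, splits_iff_card_roots.1 (IsAlgClosed.splits P)]

theorem IsYablonskiiVorobev.natDegree_eq {N n : ℕ} {Q : ℂ[X]} (h : IsYablonskiiVorobev N n Q) :
    Q.natDegree = n * (n + 1) / 2 := by
  have hsum : (Q.natDegree : ℂ) = ∑ k ∈ Finset.range n, ((k : ℂ) + 1) := by
    rw [← rootPowerSum_zero, ← mul_zero (2 * N + 1), h.rootPowerSum_eq]
    simp only [expansionCoeff_zero, Finset.sum_neg_distrib, neg_neg]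
  calc Q.natDegree = ∑ k ∈ Finset.range n, (k + 1) := mod_cast hsum
    _ = ∑ k ∈ Finset.range (n + 1), k := (Finset.sum_range_succ' (fun k => k) n).symm
    _ = (n + 1) * n / 2 := Finset.sum_range_id (n + 1)
    _ = n * (n + 1) / 2 := by rw [mul_comm]

theorem exists_eval_eq_rootPowerSum (N l : ℕ) :
    ∃ S : ℂ[X], S.natDegree = 2 * (N * l + 1) ∧
      ∀ (n : ℕ) (Q : ℂ[X]), IsYablonskiiVorobev N n Q →
        rootPowerSum Q ((2 * N + 1) * l) = S.eval (n : ℂ) := by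
  have hdeg : (taylor 1 (expansionCoeff N l (X : ℂ[X]) 1)).natDegree = 2 * N * l + 1 := by
    rw [natDegree_taylor, natDegree_expansionCoeff]
  refine ⟨-faulhaber (taylor 1 (expansionCoeff N l X 1)), ?_, fun n Q hQ => ?_⟩
  · rw [natDegree_neg, natDegree_faulhaber (ne_zero_of_natDegree_gt hdeg.ge), hdeg]
    ring
  · rw [hQ.rootPowerSum_eq, eval_neg, eval_faulhaber]
    simp only [taylor_eval, eval_expansionCoeff, eval_X, eval_one]

end PainleveTwo

end

theorem theorem4 (N : ℕ) (hN : 1 ≤ N) :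
    (∀ n : ℕ, 2 ≤ n →
      (∀ Q : ℂ[X], PainleveTwo.IsYablonskiiVorobev N n Q →
        Q.natDegree = n * (n + 1) / 2 ∧
        (∀ k : ℕ, 1 ≤ k → k ≤ n * (n + 1) / 2 →
          (k : ℂ) * Q.coeff (n * (n + 1) / 2 - k)
            + ∑ j ∈ Finset.Icc 1 k,
                PainleveTwo.rootPowerSum Q j * Q.coeff (n * (n + 1) / 2 - (k - j)) = 0) ∧
        (∀ m : ℕ, n * (n + 1) / 2 < m →
          PainleveTwo.rootPowerSum Q m
            + ∑ j ∈ Finset.Icc 1 (n * (n + 1) / 2),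
                Q.coeff (n * (n + 1) / 2 - j) * PainleveTwo.rootPowerSum Q (m - j) = 0)) ∧
      (∀ m : ℕ, n * (n + 1) / 2 < m →
        ∃ F : MvPolynomial (Fin (n * (n + 1) / 2)) ℚ,
          ∀ P : ℂ[X], P.Monic → P.natDegree = n * (n + 1) / 2 →
            PainleveTwo.rootPowerSum P m
              = MvPolynomial.aeval
                  (fun i : Fin (n * (n + 1) / 2) => PainleveTwo.rootPowerSum P (i + 1)) F)) ∧
    (∀ l : ℕ, 1 ≤ l →
      ∃ S : ℂ[X], S.natDegree = 2 * (N * l + 1) ∧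
        ∀ (n : ℕ) (Q : ℂ[X]), PainleveTwo.IsYablonskiiVorobev N n Q →
          PainleveTwo.rootPowerSum Q ((2 * N + 1) * l) = S.eval (n : ℂ)) := by
  refine ⟨fun n _ => ⟨fun Q hQ => ?_, fun m _ => ?_⟩, fun l _ => ?_⟩
  · rw [← hQ.natDegree_eq]
    exact ⟨rfl, fun k _ hk => PainleveTwo.newton_identity hQ.monic hk,
      fun m hm => PainleveTwo.newton_identity_of_lt hQ.monic hm⟩
  · obtain ⟨F, hF⟩ := PainleveTwo.exists_sum_map_pow_eq_aeval (A := ℚ) ℂ (n * (n + 1) / 2) m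
    exact ⟨F, fun P _ hP =>
      hF P.roots ((splits_iff_card_roots.1 (IsAlgClosed.splits P)).trans hP)⟩
  · exact PainleveTwo.exists_eval_eq_rootPowerSum N l
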